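/- Let $r\ge 1$ be an integer, $p>0$, $\kappa<0$ with $p+(r+1)\kappa\in[0,1)$, put $p_i=p+(i-1)\kappa$ and let $\delta_s(z)=(s^{p_1}z_1,\dots,s^{p_r}z_r)$, $s>0$, be the corresponding dilations of $\mathbb R^r$. Let $J_r$ be the $r\times r$ matrix with $(J_rz)_i=z_{i+1}$ for $i<r$ and $(J_rz)_r=0$, and let $e_r$ be the last canonical basis vector. Let $u_0:\mathbb R^r\to\mathbb R$ (measurable and locally bounded, possibly discontinuous) and $V_1:\mathbb R^r\to\mathbb R_+$ be such that: (i) the vector field $F_0(z)=J_rz+u_0(z)e_r$ is homogeneous of degree $\kappa$, i.e. $F_0(\delta_s(z))=s^{\kappa}\delta_s(F_0(z))$; $V_1$ is continuous, positive definite, $C^1$ on $\mathbb R^r\setminus\{0\}$ and homogeneous of some degree $m$, i.e. $V_1(\delta_s(z))=s^mV_1(z)$; and there are $c>0$, $\alpha\in(0,1)$ with $\nabla V_1(z)\cdot F_0(z)\le -c\,V_1(z)^\alpha$ for almost every $z\neq 0$ (for continuous $u_0$: for every $z\ne0$); (ii) for every $z\ne 0$, $u_0(z)\,\partial_rV_1(z)\le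 0$, and $\partial_rV_1(z)=0$ whenever $u_0(z)=0$. Let $g:[0,\infty)\to(0,\infty)$ be $C^1$ and increasing with $g(x)\to\infty$ as $x\to\infty$, let $k>0$, $\varepsilon>0$, and consider the controller $$u_\varepsilon(z,t)=g(|u_0(z)|)\,u_0(z)+k\,\mathrm{sgn}(u_0(z))\,\hat\varphi_\varepsilon(t,V_1(z)),$$ where $\mathrm{sgn}(x)=x/|x|$ for $x\ne0$, $\mathrm{sgn}(0)=[-1,1]$, and $\hat\varphi_\varepsilon(t,x)=\min\big(t,\tfrac{\varepsilon}{\varepsilon-x}\big)$ if $0\le x<\varepsilon$, $\hat\varphi_\varepsilon(t,x)=t$ if $x\ge\varepsilon$. Then, for all constants $\bar\varphi,\gamma_m,\gamma_M>0$ (on which the controller does not depend) and all measurable $\varphi,\gamma$ with $|\varphi(t)|\le\bar\varphi$ and $\gamma_m\le\gamma(t)\le\gamma_M$ for a.e. $t\ge0$, the solutions, in the sense of Filippov, of the closed-loop system $$\dot z_i=z_{i+1}\ (1\le i<r),\qquad \dot z_r=\varphi(t)+\gamma(t)\,u_\varepsilon(z,t)$$ have the following properties. No solution blows up in finite time: every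 solution on a bounded interval $[0,T)$ is bounded. Every solution $z$ on $[0,\infty)$ satisfies $$\limsup_{t\to\infty}V_1(z(t))\le\max\Big(0,\ \varepsilon\big(1-\tfrac1{\bar\Phi}\big)\Big),\qquad \bar\Phi=\frac{\bar\varphi-h_m}{k\gamma_m},\quad h_m=\min\Big(0,\min_{x\ge0}(\gamma_mg(x)-1)x\Big);$$ in particular $V_1(z(t))<\varepsilon$ for all sufficiently large $t$. -/

import Mathlib

open Set Filter Topology MeasureTheory

noncomputable section

namespace AdaptiveHOSM

/-- The `r × r` Jordan block: the `(i, j)` coefficient is `1` if `j = i + 1` and `0` otherwise. -/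
def jordanBlock (r : ℕ) : Matrix (Fin r) (Fin r) ℝ :=
  Matrix.of fun i j => if (i : ℕ) + 1 = (j : ℕ) then 1 else 0

/-- The last vector `e_r` of the canonical basis of `ℝ^r`. -/
def lastVec (r : ℕ) : Fin r → ℝ := fun i => if (i : ℕ) + 1 = r then 1 else 0

/-- The chain of integrators `J_r z + u e_r`. -/
def chain (r : ℕ) (z : Fin r → ℝ) (u : ℝ) : Fin r → ℝ :=
  Matrix.mulVec (jordanBlock r) z + u • lastVec r

/-- The weights `p_1, …, p_r` with `p_i = p + (i - 1) κ` (the index of `Fin r` starts at `0`). -/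
def weight (r : ℕ) (p κ : ℝ) : Fin r → ℝ := fun i => p + (i : ℕ) * κ

/-- The dilation `δ_s (z) = (s ^ p_1 z_1, …, s ^ p_r z_r)`. -/
def dilation {r : ℕ} (w : Fin r → ℝ) (s : ℝ) (z : Fin r → ℝ) : Fin r → ℝ :=
  fun i => s ^ (w i) * z i

/-- A real function is homogeneous of degree `q`: `f (δ_s z) = s ^ q f z` for all `s > 0`. -/
def IsHomogeneousFun {r : ℕ} (w : Fin r → ℝ) (q : ℝ) (f : (Fin r → ℝ) → ℝ) : Prop :=
  ∀ s : ℝ, 0 < s → ∀ z, f (dilation w s z) = s ^ q * f z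

/-- A vector field is homogeneous of degree `q`: `F (δ_s z) = s ^ q δ_s (F z)` for all `s > 0`. -/
def IsHomogeneousField {r : ℕ} (w : Fin r → ℝ) (q : ℝ) (F : (Fin r → ℝ) → (Fin r → ℝ)) : Prop :=
  ∀ s : ℝ, 0 < s → ∀ z, F (dilation w s z) = s ^ q • dilation w s (F z)

/-- The partial derivative `∂_r V` with respect to the last coordinate. -/
def lastPartial {r : ℕ} (V : (Fin r → ℝ) → ℝ) (z : Fin r → ℝ) : ℝ :=
  fderiv ℝ V z (lastVec r)

/-- `u₀` is a homogeneous stabilizing feedback for the chain of integrators, `V₁` is a homogeneous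
Lyapunov function for the closed loop `z' = J_r z + u₀(z) e_r`, and the two are linked by the
geometric condition on `u₀ ∂_r V₁`. The feedback may be discontinuous; measurability and local
boundedness are what solutions in the sense of Filippov presuppose. (Global finite time stability
of the closed loop is a consequence of `decay`.) -/
structure IsFeedbackLyapunovPair (r : ℕ) (p κ : ℝ)
    (u₀ V₁ : (Fin r → ℝ) → ℝ) : Prop where
  measurable_feedback : Measurable u₀
  locally_bounded_feedback : ∀ R : ℝ, ∃ M : ℝ, ∀ z : Fin r → ℝ, ‖z‖ ≤ R → |u₀ z| ≤ M
  /-- This says in particular that `u₀` is homogeneous of degree `p + r κ`. -/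
  homogeneous_field : IsHomogeneousField (weight r p κ) κ (fun z => chain r z (u₀ z))
  continuous_lyapunov : Continuous V₁
  lyapunov_zero : V₁ 0 = 0
  lyapunov_pos : ∀ z, z ≠ 0 → 0 < V₁ z
  contDiff_lyapunov : ContDiffOn ℝ 1 V₁ {0}ᶜ
  homogeneous_lyapunov : ∃ m : ℝ, IsHomogeneousFun (weight r p κ) m V₁
  /-- The derivative of `V₁` along `z' = J_r z + u₀(z) e_r` is at most `-c V₁ ^ α`. Null sets of
  states are irrelevant for Filippov solutions; for a continuous `u₀` the inequality holds at
  every `z ≠ 0` as soon as it holds almost everywhere. -/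
  decay : ∃ c : ℝ, 0 < c ∧ ∃ α ∈ Ioo (0 : ℝ) 1, ∀ᵐ z : Fin r → ℝ, z ≠ 0 →
    fderiv ℝ V₁ z (chain r z (u₀ z)) ≤ -c * V₁ z ^ α
  geometric_nonpos : ∀ z, z ≠ 0 → u₀ z * lastPartial V₁ z ≤ 0
  geometric_zero : ∀ z, z ≠ 0 → u₀ z = 0 → lastPartial V₁ z = 0

/-- The multivalued sign: `x / |x|` for `x ≠ 0`, and `[-1, 1]` at `0`. -/
def sgn (x : ℝ) : Set ℝ := if x = 0 then Icc (-1) 1 else {x / |x|}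

/-- The adaptive function: `min (t, ε / (ε - x))` for `x < ε` and `t` for `x ≥ ε`. -/
def adaptiveGain (ε t x : ℝ) : ℝ := if x < ε then min t (ε / (ε - x)) else t

/-- The set of values of the adaptive controller
`g(|u₀(z)|) u₀(z) + k sgn(u₀(z)) φ̂_ε(t, V₁(z))`. -/
def adaptiveControl {r : ℕ} (u₀ V₁ : (Fin r → ℝ) → ℝ) (g : ℝ → ℝ) (k ε : ℝ)
    (t : ℝ) (z : Fin r → ℝ) : Set ℝ :=
  {u | ∃ s ∈ sgn (u₀ z), u = g |u₀ z| * u₀ z + k * s * adaptiveGain ε t (V₁ z)}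

/-- The set of velocities of the perturbed chain of integrators `z_i' = z_{i+1}` (`i < r`),
`z_r' = φ(t) + γ(t) u`, when `u` ranges over the values of a multivalued feedback `U t z`. -/
def perturbedVelocities {r : ℕ} (φ γ : ℝ → ℝ) (U : ℝ → (Fin r → ℝ) → Set ℝ)
    (t : ℝ) (z : Fin r → ℝ) : Set (Fin r → ℝ) :=
  {v | ∃ u ∈ U t z, v = chain r z (φ t + γ t * u)}

/-- Filippov regularization (in the state variable) of a time dependent multivalued vector field:
the intersection, over all `δ > 0` and all Lebesgue null sets `N`, of the closed convex hull of
the velocities attained on `B(z, δ) \ N`. -/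
def filippov {r : ℕ} (f : ℝ → (Fin r → ℝ) → Set (Fin r → ℝ))
    (t : ℝ) (z : Fin r → ℝ) : Set (Fin r → ℝ) :=
  ⋂ (δ : ℝ) (_ : 0 < δ) (N : Set (Fin r → ℝ)) (_ : volume N = 0),
    closure (convexHull ℝ (⋃ y ∈ Metric.ball z δ \ N, f t y))

/-- `z` is a Filippov solution on the interval `I` of `z' ∈ f(t, z)`: it is absolutely continuous
on every compact subinterval of `I`, and for almost every `t ∈ I` its derivative belongs to the
Filippov regularization of `f`. -/
def IsFilippovSolutionOn {r : ℕ} (f : ℝ → (Fin r → ℝ) → Set (Fin r → ℝ)) (I : Set ℝ)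
    (z : ℝ → (Fin r → ℝ)) : Prop :=
  (∀ a b : ℝ, a ≤ b → Icc a b ⊆ I → AbsolutelyContinuousOnInterval z a b) ∧
  ∀ᵐ t : ℝ, t ∈ I → ∃ v ∈ filippov f t (z t), HasDerivAt z v t

/-- `h_m = min (0, min_{x ≥ 0} (γ_m g(x) - 1) x)`; the inner minimum is attained when `g` is
continuous on `[0, ∞)` and tends to infinity. -/
def hMin (g : ℝ → ℝ) (γm : ℝ) : ℝ := min 0 (sInf ((fun x => (γm * g x - 1) * x) '' Ici 0))

/-- `Φ̄ = (φ̄ - h_m) / (k γ_m)`. -/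
def PhiBar (g : ℝ → ℝ) (k φbar γm : ℝ) : ℝ := (φbar - hMin g γm) / (k * γm)

end AdaptiveHOSM

end

/-!
The Lyapunov function `V₁` of the unperturbed closed loop remains one for the adaptive loop wherever
the gain is large enough. The geometric condition says that `u₀` and `∂_r V₁` have opposite signs,
and that `∂_r V₁` vanishes with `u₀`. At a state `y` at time `t`, replacing `u₀` by
`φ + γ u_ε` therefore changes the derivative of `V₁` by at most
`|∂_r V₁| (φ̄ - h_m - k γ_m φ̂_ε(t, V₁))`, where `h_m` absorbs the mismatch
`(γ g(|u₀|) - 1) |u₀|` (`fderiv_velocity_le`). These bounds hold at almost every state and are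
continuous away from the origin, so they pass to the velocities of the Filippov regularization,
since closed half-spaces are convex (`fderiv_le_of_mem_filippov`). Two consequences follow.

* At all times `V₁' ≤ C |∂_r V₁|` along solutions. By homogeneity `|∂_r V₁|` is at most a multiple
  of `V₁` outside `{V₁ < 1}` (`IsHomogeneousFun.exists_lastPartial_le`), so `log (1 + V₁)` grows at
  most linearly there. Sublevel sets of `V₁` are bounded, hence there is no blow-up in finite time.
* As soon as `t ≥ Φ̄` and `V₁ > ε (1 - 1 / Φ̄)`, the gain is at least `Φ̄`, the correction is
  nonpositive and `V₁' ≤ -c V₁ ^ α`. Above any level `b > max 0 (ε (1 - 1 / Φ̄))` this rate is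
  bounded away from zero, so the solution enters `{V₁ ≤ b}` and stays there
  (`eventually_lyapunov_le`).

Solutions are only absolutely continuous. The differential inequalities are integrated through the
fundamental theorem of calculus for absolutely continuous functions
(`sub_le_mul_of_fderiv_velocity_le`) on time intervals that avoid the origin, where `V₁` need not
be differentiable.
-/

namespace AdaptiveHOSM

/-! ### Scalar comparison along absolutely continuous curves -/

theorem _root_.AbsolutelyContinuousOnInterval.lipschitzOnWith_comp {X Y : Type*}
    [PseudoMetricSpace X] [PseudoMetricSpace Y] {f : ℝ → X} {h : X → Y} {s : Set X} {a b : ℝ}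
    {K : NNReal} (hf : AbsolutelyContinuousOnInterval f a b) (hh : LipschitzOnWith K h s)
    (hs : MapsTo f (uIcc a b) s) : AbsolutelyContinuousOnInterval (h ∘ f) a b := by
  rw [absolutelyContinuousOnInterval_iff] at hf ⊢
  intro ε hε
  obtain ⟨δ, hδ, H⟩ := hf (ε / (K + 1)) (by positivity)
  refine ⟨δ, hδ, fun E hE hEδ => ?_⟩
  have h1 := H E hE hEδ
  calc ∑ i ∈ Finset.range E.1, dist ((h ∘ f) (E.2 i).1) ((h ∘ f) (E.2 i).2)
      ≤ ∑ i ∈ Finset.range E.1, K * dist (f (E.2 i).1) (f (E.2 i).2) :=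
        Finset.sum_le_sum fun i hi =>
          hh.dist_le_mul _ (hs (hE.1 i hi).1) _ (hs (hE.1 i hi).2)
    _ = K * ∑ i ∈ Finset.range E.1, dist (f (E.2 i).1) (f (E.2 i).2) := by
        rw [Finset.mul_sum]
    _ ≤ K * (ε / (K + 1)) := by gcongr
    _ < (K + 1) * (ε / (K + 1)) := by gcongr; linarith
    _ = ε := by field

theorem _root_.AbsolutelyContinuousOnInterval.contDiffOn_comp {E : Type*} [NormedAddCommGroup E]
    [NormedSpace ℝ E] {z : ℝ → E} {h : E → ℝ} {U : Set E} {a b : ℝ}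
    (hz : AbsolutelyContinuousOnInterval z a b) (hU : IsOpen U) (hh : ContDiffOn ℝ 1 h U)
    (hzU : MapsTo z (uIcc a b) U) : AbsolutelyContinuousOnInterval (h ∘ z) a b := by
  have hloc : LocallyLipschitzOn (z '' uIcc a b) h := by
    rintro _ ⟨t, ht, rfl⟩
    obtain ⟨K, s, hs, hK⟩ :=
      (hh.contDiffAt (hU.mem_nhds (hzU ht))).exists_lipschitzOnWith
    exact ⟨K, s, mem_nhdsWithin_of_mem_nhds hs, hK⟩
  obtain ⟨K, hK⟩ :=
    hloc.exists_lipschitzOnWith_of_compact (isCompact_uIcc.image_of_continuousOn hz.continuousOn)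
  exact hz.lipschitzOnWith_comp hK (mapsTo_image _ _)

/-- If a `C¹` function has derivative at most `L` along almost all velocities of an absolutely
continuous curve, then it grows along the curve at rate at most `L`. -/
theorem sub_le_mul_of_fderiv_velocity_le {E : Type*} [NormedAddCommGroup E]
    [NormedSpace ℝ E] {z : ℝ → E} {h : E → ℝ} {U : Set E} {a b L : ℝ} (hab : a ≤ b)
    (hz : AbsolutelyContinuousOnInterval z a b) (hU : IsOpen U) (hh : ContDiffOn ℝ 1 h U)
    (hzU : ∀ t ∈ Icc a b, z t ∈ U)
    (hL : ∀ᵐ t : ℝ, t ∈ Icc a b → ∃ v, HasDerivAt z v t ∧ fderiv ℝ h (z t) v ≤ L) :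
    h (z b) - h (z a) ≤ L * (b - a) := by
  have hac : AbsolutelyContinuousOnInterval (h ∘ z) a b :=
    hz.contDiffOn_comp hU hh (by rwa [uIcc_of_le hab])
  have hFTC := hac.integral_deriv_eq_sub
  have hle : ∫ t in a..b, deriv (h ∘ z) t ≤ ∫ _ in a..b, L := by
    refine intervalIntegral.integral_mono_ae_restrict hab hac.intervalIntegrable_deriv
      intervalIntegrable_const ?_
    rw [EventuallyLE, ae_restrict_iff' measurableSet_Icc]
    filter_upwards [hL] with t ht htI
    obtain ⟨v, hv, hvL⟩ := ht htI
    have hd : HasFDerivAt h (fderiv ℝ h (z t)) (z t) :=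
      ((hh.contDiffAt (hU.mem_nhds (hzU t htI))).differentiableAt one_ne_zero).hasFDerivAt
    rw [(hd.comp_hasDerivAt t hv).deriv]
    exact hvL
  rw [hFTC, intervalIntegral.integral_const, smul_eq_mul] at hle
  simp only [Function.comp_apply] at hle
  linarith

/-- A continuous function which grows at rate at most `L ≥ 0` as long as it is above the level `l`
stays below `max (W a) l + L (t - a)`: the estimate is applied from the last time the level is
attained. -/
theorem le_max_add_mul_of_growth_above {W : ℝ → ℝ} {a t l L : ℝ} (hat : a ≤ t) (hL : 0 ≤ L)
    (hW : ContinuousOn W (Icc a t))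
    (hgrow : ∀ c ∈ Icc a t, (∀ s ∈ Icc c t, l ≤ W s) → W t - W c ≤ L * (t - c)) :
    W t ≤ max (W a) l + L * (t - a) := by
  set S : Set ℝ := Icc a t ∩ W ⁻¹' Iic l
  have hSc : IsCompact S := (hW.preimage_isClosed_of_isClosed isClosed_Icc isClosed_Iic
    |> fun h => isCompact_Icc.of_isClosed_subset h inter_subset_left)
  rcases S.eq_empty_or_nonempty with hemp | hne
  · have := hgrow a ⟨le_rfl, hat⟩ fun s hs => by
      by_contra hcon
      have : s ∈ S := ⟨hs, (not_le.mp hcon).le⟩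
      simp [hemp] at this
    linarith [le_max_left (W a) l]
  · obtain ⟨c, hc, hmax⟩ := hSc.exists_isGreatest hne
    have hcW : W c ≤ l := hc.2
    have habove : ∀ s ∈ Ioc c t, l ≤ W s := fun s hs => by
      by_contra hcon
      have := hmax (show s ∈ S from ⟨⟨hc.1.1.trans hs.1.le, hs.2⟩, (not_le.mp hcon).le⟩)
      exact absurd hs.1 (not_lt.mpr this)
    rcases eq_or_lt_of_le hc.1.2 with heq | hlt
    · subst heq
      have := mul_nonneg hL (sub_nonneg.mpr hat)
      linarith [le_max_right (W a) l]
    · -- By continuity the level is attained at the last time `c`.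
      have hlc : l ≤ W c := by
        have hcont : ContinuousWithinAt W (Ioc c t) c :=
          (hW c hc.1).mono fun s hs => ⟨hc.1.1.trans hs.1.le, hs.2⟩
        have hcl : c ∈ closure (Ioc c t) := by
          rw [closure_Ioc hlt.ne]; exact ⟨le_rfl, hlt.le⟩
        have hmem := hcont.mem_closure_image hcl
        have hsub : closure (W '' Ioc c t) ⊆ Ici l :=
          closure_minimal (by rintro _ ⟨s, hs, rfl⟩; exact habove s hs) isClosed_Ici
        exact hsub hmem
      have h1 := hgrow c hc.1 fun s hs => by
        rcases eq_or_lt_of_le hs.1 with h | h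
        · rwa [← h]
        · exact habove s ⟨h, hs.2⟩
      have h2 : L * (t - c) ≤ L * (t - a) := by
        have := hc.1.1
        gcongr
      linarith [le_max_right (W a) l]

/-! ### Homogeneous functions -/

theorem weight_pos {r : ℕ} {p κ : ℝ} (hκ : κ < 0) (hpκ : 0 ≤ p + ((r : ℝ) + 1) * κ) (i : Fin r) :
    0 < weight r p κ i := by
  have hi : ((i : ℕ) : ℝ) < r := by exact_mod_cast i.2
  unfold weight
  nlinarith

section Homogeneous

variable {r : ℕ} {w : Fin r → ℝ} {m : ℝ} {V : (Fin r → ℝ) → ℝ}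

theorem continuous_dilation (hw : ∀ i, 0 < w i) (z : Fin r → ℝ) :
    Continuous fun s => dilation w s z :=
  continuous_pi fun i => (Real.continuous_rpow_const (hw i).le).mul continuous_const

theorem dilation_zero_left (hw : ∀ i, 0 < w i) (z : Fin r → ℝ) : dilation w 0 z = 0 := by
  funext i
  simp [dilation, Real.zero_rpow (hw i).ne']

theorem dilation_one (z : Fin r → ℝ) : dilation w 1 z = z := by
  funext i
  simp [dilation]

theorem IsHomogeneousFun.degree_pos (hV : IsHomogeneousFun w m V) (hr : 0 < r)
    (hw : ∀ i, 0 < w i) (hc : Continuous V) (h0 : V 0 = 0) (hpos : ∀ z, z ≠ 0 → 0 < V z) :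
    0 < m := by
  by_contra! hm
  have : Nonempty (Fin r) := ⟨⟨0, hr⟩⟩
  obtain ⟨e, he⟩ : ∃ e : Fin r → ℝ, e ≠ 0 := ⟨1, one_ne_zero⟩
  have hlim : Tendsto (fun s => V (dilation w s e)) (𝓝[>] 0) (𝓝 0) := by
    have h := (hc.comp (continuous_dilation hw e)).tendsto 0
    simp only [Function.comp_apply, dilation_zero_left hw, h0] at h
    exact h.mono_left nhdsWithin_le_nhds
  refine absurd (hpos e he) (not_lt.mpr (ge_of_tendsto hlim ?_))
  filter_upwards [Ioo_mem_nhdsGT (zero_lt_one' ℝ)] with s hs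
  rw [hV s hs.1 e]
  exact le_mul_of_one_le_left (hpos e he).le
    (Real.one_le_rpow_of_pos_of_le_one_of_nonpos hs.1 hs.2.le hm)

theorem IsHomogeneousFun.bounded_sublevel (hV : IsHomogeneousFun w m V)
    (hw : ∀ i, 0 < w i) (hc : Continuous V) (hpos : ∀ z, z ≠ 0 → 0 < V z) (hm : 0 < m) (R : ℝ) :
    ∃ B, ∀ z, V z ≤ R → ‖z‖ ≤ B := by
  rcases (Metric.sphere (0 : Fin r → ℝ) 1).eq_empty_or_nonempty with hemp | hne
  · refine ⟨0, fun z _ => ?_⟩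
    by_contra! hz
    have : (‖z‖⁻¹ • z) ∈ Metric.sphere (0 : Fin r → ℝ) 1 := by
      simp [norm_smul, hz.ne']
    simp [hemp] at this
  obtain ⟨y₀, hy₀, hmin⟩ := (isCompact_sphere (0 : Fin r → ℝ) 1).exists_isMinOn hne hc.continuousOn
  have hμ : 0 < V y₀ := hpos y₀ (by rintro rfl; simp at hy₀)
  set s₀ : ℝ := (V y₀ / R) ^ (1 / m)
  refine ⟨max 1 (∑ i, s₀ ^ (-w i)), fun z hz => ?_⟩
  rcases le_or_gt ‖z‖ 1 with h1 | h1
  · exact h1.trans (le_max_left _ _)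
  refine le_trans ?_ (le_max_right _ _)
  have hz0 : z ≠ 0 := by rintro rfl; simp at h1; linarith
  have hR : 0 < R := (hpos z hz0).trans_le hz
  have hs₀pos : 0 < s₀ := Real.rpow_pos_of_pos (div_pos hμ hR) _
  -- The orbit of `z` under the dilations crosses the unit sphere.
  obtain ⟨s, hs, hsz⟩ : ∃ s ∈ Icc (0 : ℝ) 1, ‖dilation w s z‖ = 1 := by
    have := intermediate_value_Icc (zero_le_one' ℝ) (continuous_dilation hw z).norm.continuousOn
    refine this ⟨?_, ?_⟩
    · simp [dilation_zero_left hw]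
    · simpa [dilation_one] using h1.le
  have hs0 : 0 < s := by
    refine lt_of_le_of_ne hs.1 fun h => ?_
    rw [← h, dilation_zero_left hw] at hsz
    simp at hsz
  have hle : V y₀ / R ≤ s ^ m := by
    rw [div_le_iff₀ hR]
    calc V y₀ ≤ V (dilation w s z) := hmin (by simpa using hsz)
      _ = s ^ m * V z := hV s hs0 z
      _ ≤ s ^ m * R := by gcongr
  have hs₀s : s₀ ≤ s := by
    calc s₀ ≤ (s ^ m) ^ (1 / m) :=
          Real.rpow_le_rpow (div_pos hμ hR).le hle (by positivity)
      _ = s := by rw [← Real.rpow_mul hs0.le, mul_one_div_cancel hm.ne', Real.rpow_one]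
  refine (pi_norm_le_iff_of_nonneg (Finset.sum_nonneg fun i _ => by positivity)).mpr fun i => ?_
  have hi : ‖s ^ w i * z i‖ ≤ 1 := by
    rw [← hsz]; exact norm_le_pi_norm (dilation w s z) i
  rw [norm_mul, Real.norm_of_nonneg (by positivity)] at hi
  calc ‖z i‖ = s ^ (-w i) * (s ^ w i * ‖z i‖) := by
        rw [← mul_assoc, ← Real.rpow_add hs0, neg_add_cancel, Real.rpow_zero, one_mul]
    _ ≤ s ^ (-w i) * 1 := by gcongr
    _ ≤ s₀ ^ (-w i) := by
        rw [mul_one]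
        exact Real.rpow_le_rpow_of_nonpos hs₀pos hs₀s (neg_nonpos.mpr (hw i).le)
    _ ≤ ∑ i, s₀ ^ (-w i) :=
        Finset.single_le_sum (f := fun i => s₀ ^ (-w i)) (fun j _ => by positivity)
          (Finset.mem_univ i)

/-- The dilation `δ_s` as a continuous linear map. -/
noncomputable def dilationCLM (w : Fin r → ℝ) (s : ℝ) : (Fin r → ℝ) →L[ℝ] (Fin r → ℝ) :=
  ContinuousLinearMap.pi fun i => (s ^ w i) • ContinuousLinearMap.proj i

theorem dilationCLM_apply (w : Fin r → ℝ) (s : ℝ) (z : Fin r → ℝ) :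
    dilationCLM w s z = dilation w s z := by
  funext i
  simp [dilationCLM, dilation]

theorem dilation_lastVec (hr : 0 < r) (w : Fin r → ℝ) (s : ℝ) :
    dilation w s (lastVec r) = s ^ w ⟨r - 1, by omega⟩ • lastVec r := by
  funext i
  by_cases hi : (i : ℕ) + 1 = r
  · have : i = ⟨r - 1, by omega⟩ := by ext; simp; omega
    simp [dilation, lastVec, this]
  · simp [dilation, lastVec, hi]

theorem dilation_ne_zero {s : ℝ} (hs : 0 < s) {z : Fin r → ℝ} (hz : z ≠ 0) :
    dilation w s z ≠ 0 := by
  intro h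
  refine hz (funext fun i => ?_)
  have := congrFun h i
  simpa [dilation, (Real.rpow_pos_of_pos hs (w i)).ne'] using this

/-- Outside the unit sublevel set the last partial derivative is dominated by `V`: its degree is
smaller than that of `V`, by the positive weight of the last coordinate. This linear bound is what
excludes finite time blow-up. -/
theorem IsHomogeneousFun.exists_lastPartial_le (hV : IsHomogeneousFun w m V) (hr : 0 < r)
    (hw : ∀ i, 0 < w i) (hc : Continuous V) (h0 : V 0 = 0) (hpos : ∀ z, z ≠ 0 → 0 < V z)
    (hm : 0 < m) (hd : ContDiffOn ℝ 1 V {0}ᶜ) :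
    ∃ C, 0 ≤ C ∧ ∀ z, 1 ≤ V z → |lastPartial V z| ≤ C * V z := by
  have hne : ∀ z, V z = 1 → z ≠ 0 := by rintro z hz rfl; simp [h0] at hz
  have hcomp : IsCompact {z | V z = 1} := by
    obtain ⟨B, hB⟩ := hV.bounded_sublevel hw hc hpos hm 1
    refine (isCompact_closedBall (0 : Fin r → ℝ) B).of_isClosed_subset
      (isClosed_eq hc continuous_const) fun z hz => ?_
    simpa using hB z (le_of_eq hz)
  have hcont : ContinuousOn (lastPartial V) {z | V z = 1} :=
    ((hd.continuousOn_fderiv_of_isOpen isOpen_compl_singleton le_rfl).clm_apply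
      continuousOn_const).mono fun z hz => hne z hz
  obtain ⟨C, hC⟩ := hcomp.exists_bound_of_continuousOn hcont
  refine ⟨max C 0, le_max_right _ _, fun z hz => ?_⟩
  have hz0 : z ≠ 0 := by rintro rfl; rw [h0] at hz; linarith
  have hVz : 0 < V z := hpos z hz0
  set s : ℝ := V z ^ (-1 / m) with hs
  have hs0 : 0 < s := Real.rpow_pos_of_pos hVz _
  have hs1 : s ≤ 1 := Real.rpow_le_one_of_one_le_of_nonpos hz
    (div_nonpos_of_nonpos_of_nonneg (by norm_num) hm.le)
  have hsm : s ^ m = (V z)⁻¹ := by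
    rw [hs, ← Real.rpow_mul hVz.le, div_mul_cancel₀ _ hm.ne', Real.rpow_neg_one]
  have hone : V (dilation w s z) = 1 := by
    rw [hV s hs0 z, hsm, inv_mul_cancel₀ hVz.ne']
  have hdiff : ∀ y, y ≠ 0 → HasFDerivAt V (fderiv ℝ V y) y := fun y hy =>
    ((hd.contDiffAt (isOpen_compl_singleton.mem_nhds hy)).differentiableAt
      one_ne_zero).hasFDerivAt
  -- Differentiate `V (δ_s z) = s ^ m V z` in the direction of the last coordinate.
  have hchain : s ^ m * lastPartial V z =
      s ^ w ⟨r - 1, by omega⟩ * lastPartial V (dilation w s z) := by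
    have h1 : HasFDerivAt (V ∘ dilationCLM w s)
        ((fderiv ℝ V (dilation w s z)).comp (dilationCLM w s)) z := by
      refine HasFDerivAt.comp z ?_ (dilationCLM w s).hasFDerivAt
      rw [dilationCLM_apply]
      exact hdiff _ (dilation_ne_zero hs0 hz0)
    have h2 : HasFDerivAt (V ∘ dilationCLM w s) (s ^ m • fderiv ℝ V z) z := by
      have : V ∘ dilationCLM w s = fun y => s ^ m • V y := by
        funext y
        simp [dilationCLM_apply, hV s hs0 y]
      rw [this]
      exact HasFDerivAt.const_smul (hdiff z hz0) (s ^ m)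
    have h3 := DFunLike.congr_fun (h2.unique h1) (lastVec r)
    simpa [dilationCLM_apply, dilation_lastVec hr, lastPartial] using h3
  rw [hsm, inv_mul_eq_iff_eq_mul₀ hVz.ne'] at hchain
  have hw1 : s ^ w ⟨r - 1, by omega⟩ ≤ 1 := Real.rpow_le_one hs0.le hs1 (hw _).le
  have hb : |lastPartial V (dilation w s z)| ≤ max C 0 := (hC _ hone).trans (le_max_left _ _)
  rw [hchain, abs_mul, abs_mul, abs_of_pos hVz, abs_of_pos (Real.rpow_pos_of_pos hs0 _), mul_comm]
  gcongr
  calc _ ≤ 1 * max C 0 := mul_le_mul hw1 hb (abs_nonneg _) zero_le_one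
    _ = _ := one_mul _

end Homogeneous

/-! ### The Filippov regularization -/

/-- A closed half-space containing the velocities at almost all nearby states contains the
regularized velocities. -/
theorem clm_le_of_mem_filippov {r : ℕ} {f : ℝ → (Fin r → ℝ) → Set (Fin r → ℝ)} {t : ℝ}
    {z v : Fin r → ℝ} (hv : v ∈ filippov f t z) (L : (Fin r → ℝ) →L[ℝ] ℝ) {a : ℝ}
    (h : ∃ δ > 0, ∀ᵐ y, y ∈ Metric.ball z δ → ∀ u ∈ f t y, L u ≤ a) : L v ≤ a := by
  obtain ⟨δ, hδ, hae⟩ := h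
  simp only [filippov, mem_iInter] at hv
  have hmem := hv δ hδ _ (ae_iff.mp hae)
  have hconv : Convex ℝ {u | L u ≤ a} := convex_halfSpace_le L.toLinearMap.isLinear a
  have hclosed : IsClosed {u | L u ≤ a} := isClosed_le L.continuous continuous_const
  refine closure_minimal (convexHull_min ?_ hconv) hclosed hmem
  simp only [iUnion_subset_iff]
  rintro y ⟨hy, hyN⟩ u hu
  simp only [mem_ofPred_eq, not_not] at hyN
  exact hyN hy u hu

/-- If the derivative of `V` along locally bounded velocities is bounded by a continuous function
`B` at almost all states near `z`, the bound persists at `z` for the regularized velocities. -/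
theorem fderiv_le_of_mem_filippov {r : ℕ} {f : ℝ → (Fin r → ℝ) → Set (Fin r → ℝ)} {t : ℝ}
    {z v : Fin r → ℝ} (hv : v ∈ filippov f t z) {V B : (Fin r → ℝ) → ℝ}
    (hV : ContinuousAt (fderiv ℝ V) z) (hB : ContinuousAt B z) {M : ℝ}
    (hM : ∀ᶠ y in 𝓝 z, ∀ u ∈ f t y, ‖u‖ ≤ M)
    (hle : ∃ P : (Fin r → ℝ) → Prop, (∀ᶠ y in 𝓝 z, P y) ∧
      ∀ᵐ y, P y → ∀ u ∈ f t y, fderiv ℝ V y u ≤ B y) :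
    fderiv ℝ V z v ≤ B z := by
  obtain ⟨P, hP, hle⟩ := hle
  refine le_of_forall_pos_le_add fun η hη => clm_le_of_mem_filippov hv _ ?_
  set M' : ℝ := max M 0
  have hnear : ∀ᶠ y in 𝓝 z, ‖fderiv ℝ V z - fderiv ℝ V y‖ < η / (2 * (M' + 1)) := by
    have h : Tendsto (fun y => ‖fderiv ℝ V z - fderiv ℝ V y‖) (𝓝 z) (𝓝 0) := by
      simpa using ((tendsto_const_nhds (x := fderiv ℝ V z)).sub hV.tendsto).norm
    exact h.eventually_lt_const (by positivity)
  have hBnear : ∀ᶠ y in 𝓝 z, B y < B z + η / 2 := hB.eventually_lt_const (by linarith)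
  obtain ⟨δ, hδ, hball⟩ := Metric.eventually_nhds_iff_ball.mp (hP.and (hM.and (hnear.and hBnear)))
  refine ⟨δ, hδ, ?_⟩
  filter_upwards [hle] with y hy hyb u hu
  obtain ⟨h1, h2, h3, h4⟩ := hball y hyb
  have h5 : (fderiv ℝ V z - fderiv ℝ V y) u ≤ η / 2 := by
    calc (fderiv ℝ V z - fderiv ℝ V y) u
        ≤ ‖(fderiv ℝ V z - fderiv ℝ V y) u‖ := Real.le_norm_self _
      _ ≤ ‖fderiv ℝ V z - fderiv ℝ V y‖ * ‖u‖ := ContinuousLinearMap.le_opNorm _ _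
      _ ≤ η / (2 * (M' + 1)) * (M' + 1) := by
          gcongr
          linarith [h2 u hu, le_max_left M 0]
      _ = η / 2 := by field
  have h6 := hy h1 u hu
  rw [sub_apply] at h5
  linarith

/-! ### The gain and the constant `h_m` -/

theorem adaptiveGain_nonneg {ε t x : ℝ} (hε : 0 < ε) (ht : 0 ≤ t) : 0 ≤ adaptiveGain ε t x := by
  unfold adaptiveGain
  split_ifs with h
  · exact le_min ht (div_nonneg hε.le (sub_pos.mpr h).le)
  · exact ht

theorem adaptiveGain_le (ε t x : ℝ) : adaptiveGain ε t x ≤ t := by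
  unfold adaptiveGain
  split_ifs
  · exact min_le_left _ _
  · exact le_rfl

/-- The gain reaches `Φ` once `t ≥ Φ` and the state lies outside the set where
`ε / (ε - x) < Φ`. -/
theorem le_adaptiveGain {ε t x Φ : ℝ} (hΦ : 0 < Φ) (ht : Φ ≤ t)
    (hx : ε * (1 - 1 / Φ) ≤ x) : Φ ≤ adaptiveGain ε t x := by
  unfold adaptiveGain
  split_ifs with h
  · refine le_min ht ((le_div_iff₀ (sub_pos.mpr h)).mpr ?_)
    have h1 : Φ * (ε * (1 - 1 / Φ)) ≤ Φ * x := by gcongr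
    have h2 : Φ * (ε * (1 - 1 / Φ)) = Φ * ε - ε := by field
    linarith
  · exact ht

theorem hMin_nonpos (g : ℝ → ℝ) (γm : ℝ) : hMin g γm ≤ 0 := min_le_left _ _

theorem hMin_le {g : ℝ → ℝ} {γm : ℝ} (hg_pos : ∀ x, 0 ≤ x → 0 < g x)
    (hg_lim : Tendsto g atTop atTop) (hγm : 0 < γm) {x : ℝ} (hx : 0 ≤ x) :
    hMin g γm ≤ (γm * g x - 1) * x := by
  refine (min_le_right _ _).trans (csInf_le ?_ (mem_image_of_mem _ hx))
  obtain ⟨X, hX⟩ := eventually_atTop.mp (hg_lim.eventually_ge_atTop (1 / γm))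
  refine ⟨-|X|, ?_⟩
  rintro _ ⟨y, hy, rfl⟩
  have hy0 : 0 ≤ y := hy
  have h1 : 0 < γm * g y := mul_pos hγm (hg_pos y hy0)
  rcases le_total X y with h | h
  · have h2 : 1 ≤ γm * g y := by
      have := hX y h
      rwa [div_le_iff₀' hγm] at this
    have : 0 ≤ (γm * g y - 1) * y := mul_nonneg (by linarith) hy0
    exact (neg_nonpos.mpr (abs_nonneg X)).trans this
  · have h2 : 0 ≤ γm * g y * y := by positivity
    have h3 : X ≤ |X| := le_abs_self X
    show -|X| ≤ (γm * g y - 1) * y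
    linarith

theorem PhiBar_pos {g : ℝ → ℝ} {k φbar γm : ℝ} (hk : 0 < k) (hφbar : 0 < φbar) (hγm : 0 < γm) :
    0 < PhiBar g k φbar γm :=
  div_pos (by linarith [hMin_nonpos g γm]) (mul_pos hk hγm)

/-! ### The closed-loop velocities -/

theorem chain_add (r : ℕ) (z : Fin r → ℝ) (a b : ℝ) :
    chain r z (a + b) = chain r z a + b • lastVec r := by
  simp only [chain, add_smul, add_assoc]

theorem continuous_chain (r : ℕ) : Continuous fun q : (Fin r → ℝ) × ℝ => chain r q.1 q.2 := by
  unfold chain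
  fun_prop

theorem abs_le_one_of_mem_sgn {x s : ℝ} (hs : s ∈ sgn x) : |s| ≤ 1 := by
  unfold sgn at hs
  split_ifs at hs with h
  · exact abs_le.mpr hs
  · rw [mem_singleton_iff] at hs
    rw [hs, abs_div, abs_abs, div_self (abs_ne_zero.mpr h)]

/-- Effect of the perturbed control on the derivative of `V`. The geometric condition makes the
control push along `-sgn (∂_r V)`, so that it competes with the perturbation only through
`|∂_r V|`. -/
theorem fderiv_velocity_le {r : ℕ} {u₀ V : (Fin r → ℝ) → ℝ} {g : ℝ → ℝ}
    {k ε φbar γm t : ℝ} {φ γ : ℝ → ℝ} {y v : Fin r → ℝ}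
    (hnonpos : u₀ y * lastPartial V y ≤ 0) (hzero : u₀ y = 0 → lastPartial V y = 0)
    (hg_pos : ∀ x, 0 ≤ x → 0 < g x) (hg_lim : Tendsto g atTop atTop) (hk : 0 < k) (hε : 0 < ε)
    (hγm : 0 < γm) (ht : 0 ≤ t) (hφ : |φ t| ≤ φbar) (hγ : γm ≤ γ t)
    (hv : v ∈ perturbedVelocities φ γ (adaptiveControl u₀ V g k ε) t y) :
    fderiv ℝ V y v ≤ fderiv ℝ V y (chain r y (u₀ y)) +
      |lastPartial V y| * (φbar - hMin g γm - k * γm * adaptiveGain ε t (V y)) := by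
  obtain ⟨_, ⟨s, hs, rfl⟩, rfl⟩ := hv
  set a := adaptiveGain ε t (V y)
  have ha : 0 ≤ a := adaptiveGain_nonneg hε ht
  set d := φ t + γ t * (g |u₀ y| * u₀ y + k * s * a) - u₀ y with hd
  have hsplit : φ t + γ t * (g |u₀ y| * u₀ y + k * s * a) = u₀ y + d := by rw [hd]; ring
  rw [hsplit, chain_add, map_add, map_smul, smul_eq_mul]
  refine add_le_add_right (a := fderiv ℝ V y (chain r y (u₀ y))) ?_
  change d * lastPartial V y ≤ _
  by_cases hu : u₀ y = 0
  · simp [hzero hu]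
  · rw [sgn, if_neg hu, mem_singleton_iff] at hs
    set x := |u₀ y| with hx
    have hxpos : 0 < x := abs_pos.mpr hu
    -- `s` is the sign of `u₀ y`, and `-s` that of the partial derivative.
    have hux : u₀ y = s * x := by rw [hs]; field
    have hsP : s * lastPartial V y = -|lastPartial V y| := by
      rcases lt_or_gt_of_ne hu with h | h
      · have hs1 : s = -1 := by rw [hs, hx, abs_of_neg h, div_neg, div_self hu]
        have hP : 0 ≤ lastPartial V y := by nlinarith
        rw [hs1, abs_of_nonneg hP]; ring
      · have hs1 : s = 1 := by rw [hs, hx, abs_of_pos h, div_self hu]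
        have hP : lastPartial V y ≤ 0 := by nlinarith
        rw [hs1, abs_of_nonpos hP]; ring
    have hφP : φ t * lastPartial V y ≤ φbar * |lastPartial V y| := by
      refine (le_abs_self _).trans ?_
      rw [abs_mul]
      gcongr
    have hgx : 0 < g x := hg_pos x hxpos.le
    have h1 : hMin g γm ≤ (γ t * g x - 1) * x :=
      (hMin_le hg_pos hg_lim hγm hxpos.le).trans (by gcongr)
    have h2 : k * γm * a ≤ k * γ t * a := by gcongr
    have hexp : d * lastPartial V y = φ t * lastPartial V y
        - |lastPartial V y| * ((γ t * g x - 1) * x + k * γ t * a) := by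
      calc d * lastPartial V y = φ t * lastPartial V y
            + ((γ t * g x - 1) * x + k * γ t * a) * (s * lastPartial V y) := by
              rw [hd, hux]; ring
        _ = _ := by rw [hsP]; ring
    have h3 : |lastPartial V y| * (hMin g γm + k * γm * a) ≤
        |lastPartial V y| * ((γ t * g x - 1) * x + k * γ t * a) := by gcongr
    calc d * lastPartial V y = _ := hexp
      _ ≤ |lastPartial V y| * (φbar - hMin g γm - k * γm * a) := by linarith

theorem perturbedVelocities_locally_bounded {r : ℕ} {u₀ V : (Fin r → ℝ) → ℝ} {g : ℝ → ℝ}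
    {k ε t : ℝ} (φ γ : ℝ → ℝ)
    (hu₀ : ∀ R : ℝ, ∃ M : ℝ, ∀ z : Fin r → ℝ, ‖z‖ ≤ R → |u₀ z| ≤ M)
    (hg_pos : ∀ x, 0 ≤ x → 0 < g x) (hg_mono : MonotoneOn g (Ici 0)) (hε : 0 < ε) (ht : 0 ≤ t)
    (z : Fin r → ℝ) :
    ∃ M, ∀ᶠ y in 𝓝 z, ∀ v ∈ perturbedVelocities φ γ (adaptiveControl u₀ V g k ε) t y,
      ‖v‖ ≤ M := by
  obtain ⟨M₀, hM₀⟩ := hu₀ (‖z‖ + 1)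
  set A : ℝ := |φ t| + |γ t| * (g M₀ * M₀ + |k| * t)
  obtain ⟨C, hC⟩ := ((isCompact_closedBall (0 : Fin r → ℝ) (‖z‖ + 1)).prod
    (isCompact_Icc (a := -A) (b := A))).exists_bound_of_continuousOn
      (continuous_chain r).continuousOn
  refine ⟨C, ?_⟩
  have hnorm : ∀ᶠ y in 𝓝 z, ‖y‖ < ‖z‖ + 1 :=
    continuous_norm.continuousAt.eventually_lt_const (by linarith)
  filter_upwards [hnorm] with y hy
  rintro _ ⟨_, ⟨s, hs, rfl⟩, rfl⟩
  refine hC (y, _) ⟨by simpa using hy.le, abs_le.mp ?_⟩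
  have hu : |u₀ y| ≤ M₀ := hM₀ y hy.le
  have hM₀0 : 0 ≤ M₀ := (abs_nonneg _).trans hu
  have ha : |adaptiveGain ε t (V y)| ≤ t := by
    rw [abs_of_nonneg (adaptiveGain_nonneg hε ht)]
    exact adaptiveGain_le _ _ _
  have hg : |g (|u₀ y|)| ≤ g M₀ := by
    rw [abs_of_pos (hg_pos _ (abs_nonneg _))]
    exact hg_mono (abs_nonneg (u₀ y)) hM₀0 hu
  have hgM : 0 < g M₀ := hg_pos _ hM₀0
  have hs1 := abs_le_one_of_mem_sgn hs
  calc |φ t + γ t * (g |u₀ y| * u₀ y + k * s * adaptiveGain ε t (V y))|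
      ≤ |φ t| + |γ t| * (|g (|u₀ y|)| * |u₀ y| + |k| * |s| * |adaptiveGain ε t (V y)|) := by
        refine (abs_add_le _ _).trans ?_
        rw [abs_mul]
        gcongr
        refine (abs_add_le _ _).trans ?_
        rw [abs_mul, abs_mul, abs_mul]
    _ ≤ |φ t| + |γ t| * (g M₀ * M₀ + |k| * 1 * t) := by gcongr
    _ = A := by rw [mul_one]

/-! ### The Lyapunov function along Filippov velocities -/

section ClosedLoop

variable {r : ℕ} {p κ : ℝ} {u₀ V₁ : (Fin r → ℝ) → ℝ} {g : ℝ → ℝ} {k ε φbar γm t : ℝ}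
  {φ γ : ℝ → ℝ} {z v : Fin r → ℝ}

theorem IsFeedbackLyapunovPair.hasFDerivAt (hpair : IsFeedbackLyapunovPair r p κ u₀ V₁)
    (hz : z ≠ 0) : HasFDerivAt V₁ (fderiv ℝ V₁ z) z :=
  ((hpair.contDiff_lyapunov.contDiffAt (isOpen_compl_singleton.mem_nhds hz)).differentiableAt
    one_ne_zero).hasFDerivAt

theorem IsFeedbackLyapunovPair.continuousAt_fderiv (hpair : IsFeedbackLyapunovPair r p κ u₀ V₁)
    (hz : z ≠ 0) : ContinuousAt (fderiv ℝ V₁) z :=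
  (hpair.contDiff_lyapunov.continuousOn_fderiv_of_isOpen isOpen_compl_singleton le_rfl).continuousAt
    (isOpen_compl_singleton.mem_nhds hz)

/-- At every time the derivative of `V₁` along the closed loop is at most proportional to
`|∂_r V₁|`, whatever the value of the gain. -/
theorem fderiv_le_abs_lastPartial_mul (hpair : IsFeedbackLyapunovPair r p κ u₀ V₁)
    (hg_pos : ∀ x, 0 ≤ x → 0 < g x) (hg_mono : MonotoneOn g (Ici 0))
    (hg_lim : Tendsto g atTop atTop) (hk : 0 < k) (hε : 0 < ε) (hγm : 0 < γm) (ht : 0 ≤ t)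
    (hφ : |φ t| ≤ φbar) (hγ : γm ≤ γ t) (hz : z ≠ 0)
    (hv : v ∈ filippov (perturbedVelocities φ γ (adaptiveControl u₀ V₁ g k ε)) t z) :
    fderiv ℝ V₁ z v ≤ |lastPartial V₁ z| * (φbar - hMin g γm) := by
  obtain ⟨c, hc, α, -, hdecay⟩ := hpair.decay
  obtain ⟨M, hM⟩ := perturbedVelocities_locally_bounded (V := V₁) (k := k) φ γ
    hpair.locally_bounded_feedback hg_pos hg_mono hε ht z
  refine fderiv_le_of_mem_filippov (B := fun y => |lastPartial V₁ y| * (φbar - hMin g γm)) hv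
    (hpair.continuousAt_fderiv hz) ?_ hM ⟨fun y => y ≠ 0, eventually_ne_nhds hz, ?_⟩
  · exact (((hpair.continuousAt_fderiv hz).clm_apply continuousAt_const).abs).mul
      continuousAt_const
  filter_upwards [hdecay] with y hy hy0 u hu
  have h1 := fderiv_velocity_le (hpair.geometric_nonpos y hy0) (hpair.geometric_zero y hy0)
    hg_pos hg_lim hk hε hγm ht hφ hγ hu
  have h2 : 0 ≤ c * V₁ y ^ α :=
    mul_nonneg hc.le (Real.rpow_nonneg (hpair.lyapunov_pos y hy0).le _)
  have h3 : 0 ≤ |lastPartial V₁ y| * (k * γm * adaptiveGain ε t (V₁ y)) :=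
    mul_nonneg (abs_nonneg _)
      (mul_nonneg (mul_pos hk hγm).le (adaptiveGain_nonneg hε ht))
  have h4 := hy hy0
  linarith

/-- Where the gain has reached `Φ̄` it dominates the perturbation, and `V₁` decays as for the
unperturbed system. -/
theorem fderiv_le_neg_rpow (hpair : IsFeedbackLyapunovPair r p κ u₀ V₁)
    (hg_pos : ∀ x, 0 ≤ x → 0 < g x) (hg_mono : MonotoneOn g (Ici 0))
    (hg_lim : Tendsto g atTop atTop) (hk : 0 < k) (hε : 0 < ε) (hφbar : 0 < φbar) (hγm : 0 < γm)
    (hφ : |φ t| ≤ φbar) (hγ : γm ≤ γ t) (hz : z ≠ 0)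
    (hv : v ∈ filippov (perturbedVelocities φ γ (adaptiveControl u₀ V₁ g k ε)) t z)
    {c α : ℝ} (hdecay : ∀ᵐ y : Fin r → ℝ, y ≠ 0 →
      fderiv ℝ V₁ y (chain r y (u₀ y)) ≤ -c * V₁ y ^ α)
    (ht : PhiBar g k φbar γm ≤ t) (hzb : ε * (1 - 1 / PhiBar g k φbar γm) < V₁ z) :
    fderiv ℝ V₁ z v ≤ -c * V₁ z ^ α := by
  have hΦ : 0 < PhiBar g k φbar γm := PhiBar_pos hk hφbar hγm
  have ht0 : 0 ≤ t := hΦ.le.trans ht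
  obtain ⟨M, hM⟩ := perturbedVelocities_locally_bounded (V := V₁) (k := k) φ γ
    hpair.locally_bounded_feedback hg_pos hg_mono hε ht0 z
  refine fderiv_le_of_mem_filippov (B := fun y => -c * V₁ y ^ α) hv
    (hpair.continuousAt_fderiv hz) ?_ hM
    ⟨fun y => y ≠ 0 ∧ ε * (1 - 1 / PhiBar g k φbar γm) < V₁ y, (eventually_ne_nhds hz).and
      (hpair.continuous_lyapunov.continuousAt.eventually_const_lt hzb), ?_⟩
  · exact continuousAt_const.mul (hpair.continuous_lyapunov.continuousAt.rpow_const
      (Or.inl (hpair.lyapunov_pos z hz).ne'))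
  filter_upwards [hdecay] with y hy ⟨hy0, hyb⟩ u hu
  have h1 := fderiv_velocity_le (hpair.geometric_nonpos y hy0) (hpair.geometric_zero y hy0)
    hg_pos hg_lim hk hε hγm ht0 hφ hγ hu
  have h2 : φbar - hMin g γm ≤ k * γm * adaptiveGain ε t (V₁ y) := by
    have := le_adaptiveGain hΦ ht hyb.le
    rwa [PhiBar, div_le_iff₀' (mul_pos hk hγm)] at this
  have h3 : |lastPartial V₁ y| * (φbar - hMin g γm - k * γm * adaptiveGain ε t (V₁ y)) ≤ 0 :=
    mul_nonpos_of_nonneg_of_nonpos (abs_nonneg _) (by linarith)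
  have h4 := hy hy0
  linarith

end ClosedLoop

/-! ### Absence of blow-up and asymptotic bound -/

theorem IsFilippovSolutionOn.continuousOn_Icc {r : ℕ} {f : ℝ → (Fin r → ℝ) → Set (Fin r → ℝ)}
    {I : Set ℝ} {z : ℝ → (Fin r → ℝ)} (hz : IsFilippovSolutionOn f I z) {a b : ℝ} (hab : a ≤ b)
    (hI : Icc a b ⊆ I) : ContinuousOn z (Icc a b) := by
  simpa [uIcc_of_le hab] using (hz.1 a b hab hI).continuousOn

theorem exists_norm_le_of_isFilippovSolutionOn {r : ℕ} (hr : 0 < r) {p κ : ℝ} (hκ : κ < 0)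
    (hpκ : 0 ≤ p + ((r : ℝ) + 1) * κ) {u₀ V₁ : (Fin r → ℝ) → ℝ}
    (hpair : IsFeedbackLyapunovPair r p κ u₀ V₁) {g : ℝ → ℝ} (hg_pos : ∀ x, 0 ≤ x → 0 < g x)
    (hg_mono : MonotoneOn g (Ici 0)) (hg_lim : Tendsto g atTop atTop) {k ε φbar γm : ℝ}
    (hk : 0 < k) (hε : 0 < ε) (hφbar : 0 < φbar) (hγm : 0 < γm) {φ γ : ℝ → ℝ}
    (hφ : ∀ᵐ t : ℝ, 0 ≤ t → |φ t| ≤ φbar) (hγ : ∀ᵐ t : ℝ, 0 ≤ t → γm ≤ γ t) {T : ℝ}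
    {z : ℝ → (Fin r → ℝ)}
    (hz : IsFilippovSolutionOn (perturbedVelocities φ γ (adaptiveControl u₀ V₁ g k ε))
      (Ico 0 T) z) : ∃ R : ℝ, ∀ t ∈ Ico 0 T, ‖z t‖ ≤ R := by
  have hw : ∀ i, 0 < weight r p κ i := weight_pos hκ hpκ
  obtain ⟨m, hm⟩ := hpair.homogeneous_lyapunov
  have hm0 : 0 < m := hm.degree_pos hr hw hpair.continuous_lyapunov hpair.lyapunov_zero
    hpair.lyapunov_pos
  obtain ⟨C, hC0, hC⟩ := hm.exists_lastPartial_le hr hw hpair.continuous_lyapunov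
    hpair.lyapunov_zero hpair.lyapunov_pos hm0 hpair.contDiff_lyapunov
  have hVnn : ∀ y, 0 ≤ V₁ y := fun y => by
    rcases eq_or_ne y 0 with rfl | hy
    · exact hpair.lyapunov_zero.ge
    · exact (hpair.lyapunov_pos y hy).le
  have hD : 0 ≤ φbar - hMin g γm := by linarith [hMin_nonpos g γm]
  set L : ℝ := C * (φbar - hMin g γm) with hLdef
  have hL : 0 ≤ L := mul_nonneg hC0 hD
  set h : (Fin r → ℝ) → ℝ := fun y => Real.log (1 + V₁ y)
  have h1V : ∀ y, 0 < 1 + V₁ y := fun y => by linarith [hVnn y]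
  have hhc : Continuous h :=
    (continuous_const.add hpair.continuous_lyapunov).log fun y => (h1V y).ne'
  have hhd : ContDiffOn ℝ 1 h {0}ᶜ :=
    (contDiffOn_const.add hpair.contDiff_lyapunov).log fun y _ => (h1V y).ne'
  -- `log (1 + V₁)` grows at most linearly in time while `V₁ ≥ 1`.
  have hbound : ∀ t ∈ Ico 0 T, h (z t) ≤ max (h (z 0)) (Real.log 2) + L * T := by
    intro t ht
    have hsub : Icc 0 t ⊆ Ico 0 T := fun s hs => ⟨hs.1, hs.2.trans_lt ht.2⟩
    have key := le_max_add_mul_of_growth_above (W := h ∘ z) (l := Real.log 2) ht.1 hL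
      (hhc.comp_continuousOn (hz.continuousOn_Icc ht.1 hsub)) fun c hc habove => by
        have hV1 : ∀ s ∈ Icc c t, 1 ≤ V₁ (z s) := fun s hs => by
          have := (Real.log_le_log_iff two_pos (h1V _)).mp (habove s hs)
          linarith
        have hz0 : ∀ s ∈ Icc c t, z s ≠ 0 := fun s hs h0 => by
          have := hV1 s hs
          rw [h0, hpair.lyapunov_zero] at this
          linarith
        have hct : Icc c t ⊆ Ico 0 T := (Icc_subset_Icc_left hc.1).trans hsub
        refine sub_le_mul_of_fderiv_velocity_le hc.2 (hz.1 c t hc.2 hct)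
          isOpen_compl_singleton hhd hz0 ?_
        filter_upwards [hz.2, hφ, hγ] with s hs hφs hγs hsI
        obtain ⟨v, hv, hder⟩ := hs (hct hsI)
        refine ⟨v, hder, ?_⟩
        have hs0 : 0 ≤ s := hc.1.trans hsI.1
        have hf := fderiv_le_abs_lastPartial_mul hpair hg_pos hg_mono hg_lim hk hε hγm hs0
          (hφs hs0) (hγs hs0) (hz0 s hsI) hv
        have hlog : HasFDerivAt h ((1 + V₁ (z s))⁻¹ • fderiv ℝ V₁ (z s)) (z s) :=
          ((hpair.hasFDerivAt (hz0 s hsI)).const_add 1).log (h1V _).ne'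
        rw [hlog.fderiv, smul_apply, smul_eq_mul, inv_mul_le_iff₀ (h1V _)]
        calc fderiv ℝ V₁ (z s) v ≤ |lastPartial V₁ (z s)| * (φbar - hMin g γm) := hf
          _ ≤ C * V₁ (z s) * (φbar - hMin g γm) := by gcongr; exact hC _ (hV1 s hsI)
          _ = V₁ (z s) * L := by rw [hLdef]; ring
          _ ≤ (1 + V₁ (z s)) * L := by gcongr; linarith
    have hLt : L * (t - 0) ≤ L * T := by
      have := ht.2
      gcongr
      linarith
    simp only [Function.comp_apply] at key
    linarith
  obtain ⟨B, hB⟩ := hm.bounded_sublevel hw hpair.continuous_lyapunov hpair.lyapunov_pos hm0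
    (Real.exp (max (h (z 0)) (Real.log 2) + L * T))
  refine ⟨B, fun t ht => hB _ ?_⟩
  have := (Real.log_le_iff_le_exp (h1V _)).mp (hbound t ht)
  linarith

/-- Above any level larger than `max 0 (ε (1 - 1 / Φ̄))` the Lyapunov function decreases at a
uniform rate once `t ≥ Φ̄`, so that the solution reaches the sublevel set and cannot leave it. -/
theorem eventually_lyapunov_le {r : ℕ} {p κ : ℝ} {u₀ V₁ : (Fin r → ℝ) → ℝ}
    (hpair : IsFeedbackLyapunovPair r p κ u₀ V₁) {g : ℝ → ℝ} (hg_pos : ∀ x, 0 ≤ x → 0 < g x)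
    (hg_mono : MonotoneOn g (Ici 0)) (hg_lim : Tendsto g atTop atTop) {k ε φbar γm : ℝ}
    (hk : 0 < k) (hε : 0 < ε) (hφbar : 0 < φbar) (hγm : 0 < γm) {φ γ : ℝ → ℝ}
    (hφ : ∀ᵐ t : ℝ, 0 ≤ t → |φ t| ≤ φbar) (hγ : ∀ᵐ t : ℝ, 0 ≤ t → γm ≤ γ t)
    {z : ℝ → (Fin r → ℝ)}
    (hz : IsFilippovSolutionOn (perturbedVelocities φ γ (adaptiveControl u₀ V₁ g k ε))
      (Ici 0) z) {b : ℝ} (hb : max 0 (ε * (1 - 1 / PhiBar g k φbar γm)) < b) :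
    ∀ᶠ t in atTop, V₁ (z t) ≤ b := by
  obtain ⟨c, hc, α, hα, hdecay⟩ := hpair.decay
  have hΦ : 0 < PhiBar g k φbar γm := PhiBar_pos hk hφbar hγm
  set Φ := PhiBar g k φbar γm
  obtain ⟨hb0, hbΦ⟩ := max_lt_iff.mp hb
  set η : ℝ := c * b ^ α
  have hηpos : 0 < η := mul_pos hc (Real.rpow_pos_of_pos hb0 _)
  have hdecr : ∀ s t, Φ ≤ s → s ≤ t → (∀ x ∈ Icc s t, b ≤ V₁ (z x)) →
      V₁ (z t) - V₁ (z s) ≤ -η * (t - s) := by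
    intro s t hs hst habove
    have hz0 : ∀ x ∈ Icc s t, z x ≠ 0 := fun x hx h0 => by
      have := habove x hx
      rw [h0, hpair.lyapunov_zero] at this
      linarith
    have hsub : Icc s t ⊆ Ici 0 := fun x hx => hΦ.le.trans (hs.trans hx.1)
    refine sub_le_mul_of_fderiv_velocity_le hst (hz.1 s t hst hsub) isOpen_compl_singleton
      hpair.contDiff_lyapunov hz0 ?_
    filter_upwards [hz.2, hφ, hγ] with x hx hφx hγx hxI
    obtain ⟨v, hv, hder⟩ := hx (hsub hxI)
    refine ⟨v, hder, ?_⟩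
    have hf := fderiv_le_neg_rpow hpair hg_pos hg_mono hg_lim hk hε hφbar hγm
      (hφx (hsub hxI)) (hγx (hsub hxI)) (hz0 x hxI) hv hdecay (hs.trans hxI.1)
      (hbΦ.trans_le (habove x hxI))
    have hpow : c * b ^ α ≤ c * V₁ (z x) ^ α :=
      mul_le_mul_of_nonneg_left (Real.rpow_le_rpow hb0.le (habove x hxI) hα.1.le) hc.le
    linarith
  obtain ⟨t₀, ht₀, hVt₀⟩ : ∃ t₀, Φ ≤ t₀ ∧ V₁ (z t₀) ≤ b := by
    by_contra! hcon
    have hpos : 0 < V₁ (z Φ) := hb0.trans (hcon Φ le_rfl)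
    have hle : Φ ≤ Φ + V₁ (z Φ) / η := by linarith [div_pos hpos hηpos]
    have h1 := hdecr Φ _ le_rfl hle fun x hx => (hcon x hx.1).le
    have h2 := hcon _ hle
    have h3 : -η * (Φ + V₁ (z Φ) / η - Φ) = -V₁ (z Φ) := by field
    linarith
  filter_upwards [eventually_ge_atTop t₀] with t ht
  have hsub : Icc t₀ t ⊆ Ici 0 := fun x hx => hΦ.le.trans (ht₀.trans hx.1)
  have key := le_max_add_mul_of_growth_above (W := V₁ ∘ z) (l := b) ht le_rfl
    (hpair.continuous_lyapunov.comp_continuousOn (hz.continuousOn_Icc ht hsub))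
    fun s hs habove => by
      have h1 := hdecr s t (ht₀.trans hs.1) hs.2 habove
      have h2 : 0 ≤ η * (t - s) := mul_nonneg hηpos.le (sub_nonneg.mpr hs.2)
      simp only [Function.comp_apply]
      linarith
  simpa [max_eq_right hVt₀] using key

end AdaptiveHOSM

theorem theorem2
    -- the chain of integrators and the family of dilations
    (r : ℕ) (hr : 0 < r) (p κ : ℝ) (hp : 0 < p) (hκ : κ < 0)
    (hpκ : p + ((r : ℝ) + 1) * κ ∈ Set.Ico (0 : ℝ) 1)
    -- the data of the controller
    (u₀ V₁ : (Fin r → ℝ) → ℝ) (hpair : AdaptiveHOSM.IsFeedbackLyapunovPair r p κ u₀ V₁)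
    (g : ℝ → ℝ) (hg_pos : ∀ x, 0 ≤ x → 0 < g x) (hg_mono : MonotoneOn g (Set.Ici 0))
    (hg_smooth : ContDiffOn ℝ 1 g (Set.Ici 0)) (hg_lim : Filter.Tendsto g Filter.atTop Filter.atTop)
    (k : ℝ) (hk : 0 < k) (ε : ℝ) (hε : 0 < ε)
    -- the uncertainties and their bounds
    (φbar γm γM : ℝ) (hφbar : 0 < φbar) (hγm : 0 < γm) (hγM : 0 < γM)
    (φ γ : ℝ → ℝ)
    (hφ_meas : AEMeasurable φ (MeasureTheory.volume.restrict (Set.Ici 0)))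
    (hγ_meas : AEMeasurable γ (MeasureTheory.volume.restrict (Set.Ici 0)))
    (hφ : ∀ᵐ t : ℝ, 0 ≤ t → |φ t| ≤ φbar)
    (hγ : ∀ᵐ t : ℝ, 0 ≤ t → γm ≤ γ t ∧ γ t ≤ γM) :
    -- no trajectory blows up in finite time
    (∀ T : ℝ, 0 < T → ∀ z : ℝ → (Fin r → ℝ),
      AdaptiveHOSM.IsFilippovSolutionOn
        (AdaptiveHOSM.perturbedVelocities φ γ (AdaptiveHOSM.adaptiveControl u₀ V₁ g k ε))
        (Set.Ico 0 T) z →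
      ∃ R : ℝ, ∀ t ∈ Set.Ico 0 T, ‖z t‖ ≤ R) ∧
    -- the asymptotic bound, and practical stabilization into `{V₁ < ε}`
    (∀ z : ℝ → (Fin r → ℝ),
      AdaptiveHOSM.IsFilippovSolutionOn
        (AdaptiveHOSM.perturbedVelocities φ γ (AdaptiveHOSM.adaptiveControl u₀ V₁ g k ε))
        (Set.Ici 0) z →
      Filter.limsup (fun t : ℝ => ((V₁ (z t) : ℝ) : EReal)) Filter.atTop ≤
        ((max 0 (ε * (1 - 1 / AdaptiveHOSM.PhiBar g k φbar γm)) : ℝ) : EReal) ∧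
      ∀ᶠ t : ℝ in Filter.atTop, V₁ (z t) < ε) := by
  have hγ' : ∀ᵐ t : ℝ, 0 ≤ t → γm ≤ γ t := hγ.mono fun t ht h0 => (ht h0).1
  refine ⟨fun T _ z hz => AdaptiveHOSM.exists_norm_le_of_isFilippovSolutionOn hr hκ hpκ.1 hpair
    hg_pos hg_mono hg_lim hk hε hφbar hγm hφ hγ' hz, fun z hz => ?_⟩
  have hev : ∀ b, max 0 (ε * (1 - 1 / AdaptiveHOSM.PhiBar g k φbar γm)) < b →
      ∀ᶠ t in Filter.atTop, V₁ (z t) ≤ b := fun b hb =>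
    AdaptiveHOSM.eventually_lyapunov_le hpair hg_pos hg_mono hg_lim hk hε hφbar hγm hφ hγ' hz hb
  refine ⟨?_, ?_⟩
  · by_contra! hcon
    obtain ⟨q, hq, hql⟩ := EReal.lt_iff_exists_real_btwn.mp hcon
    refine absurd hql (not_lt.mpr (Filter.limsup_le_of_le (h := ?_)))
    filter_upwards [hev q (EReal.coe_lt_coe_iff.mp hq)] with t ht
    exact EReal.coe_le_coe_iff.mpr ht
  · have hlt : max 0 (ε * (1 - 1 / AdaptiveHOSM.PhiBar g k φbar γm)) < ε := by
      have hdiv : 0 < ε * (1 / AdaptiveHOSM.PhiBar g k φbar γm) :=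
        mul_pos hε (one_div_pos.mpr (AdaptiveHOSM.PhiBar_pos hk hφbar hγm))
      exact max_lt hε (by linarith)
    obtain ⟨b, hb, hbε⟩ := exists_between hlt
    exact (hev b hb).mono fun t ht => ht.trans_lt hbε
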